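/- Let $R$ be a commutative ring with identity. $R$ is called Bezout if every finitely generated ideal of $R$ is principal, and semihereditary if every finitely generated ideal of $R$ is a projective $R$-module. An element $a\in R$ is called regular if it is not a zero divisor, and adequate if for every $b\in R$ there exist $r,s\in R$ such that $a=rs$, $rR+bR=R$, and $s'R+bR\neq R$ for each non-unit divisor $s'$ of $s$. $R$ is called an elementary divisor ring if for every $m\times n$ matrix $A$ over $R$ there exist invertible matrices $P\in GL_m(R)$ and $Q\in GL_n(R)$ such that $PAQ=(d_{ij})$ is diagonal ($d_{ij}=0$ for $i\neq j$) and $d_{ii}$ divides $d_{i+1,i+1}$ for all $i<\min(m,n)$. Theorem. Let $R$ be a semihereditary Bezout ring in which every regular element is adequate. Then $R$ is an elementary divisor ring. -/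

import Mathlib

/-- A commutative ring is semihereditary if each of its finitely generated ideals is a
projective module. -/
def IsSemihereditary (R : Type*) [CommRing R] : Prop :=
  ∀ I : Ideal R, I.FG → Module.Projective R I

/-- An element `a` is adequate if for every `b` there is a factorization `a = r * s` such that
`rR + bR = R` and `s'R + bR ≠ R` for each non-unit divisor `s'` of `s`. -/
def IsAdequate {R : Type*} [CommRing R] (a : R) : Prop :=
  ∀ b : R, ∃ r s : R, a = r * s ∧ IsCoprime r b ∧
    ∀ s' : R, s' ∣ s → ¬ IsUnit s' → ¬ IsCoprime s' b

/-- A rectangular matrix `D` is in elementary divisor form if it is diagonal and each of its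
diagonal entries divides the next one. -/
def IsElementaryDivisorForm {R : Type*} [CommRing R] {m n : ℕ}
    (D : Matrix (Fin m) (Fin n) R) : Prop :=
  (∀ (i : Fin m) (j : Fin n), (i : ℕ) ≠ (j : ℕ) → D i j = 0) ∧
    ∀ (k : ℕ) (hm : k + 1 < m) (hn : k + 1 < n),
      D ⟨k, Nat.lt_of_succ_lt hm⟩ ⟨k, Nat.lt_of_succ_lt hn⟩ ∣ D ⟨k + 1, hm⟩ ⟨k + 1, hn⟩

/-- A commutative ring is an elementary divisor ring if every rectangular matrix over it is
equivalent to a diagonal matrix in which each diagonal entry divides the next one. -/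
def IsElementaryDivisorRing (R : Type*) [CommRing R] : Prop :=
  ∀ (m n : ℕ) (A : Matrix (Fin m) (Fin n) R),
    ∃ (P : Matrix (Fin m) (Fin m) R) (Q : Matrix (Fin n) (Fin n) R),
      IsUnit P ∧ IsUnit Q ∧ IsElementaryDivisorForm (P * A * Q)

/-!
# Semihereditary Bezout rings with adequate regular elements are elementary divisor rings

Semiheredity enters only through principal ideals: it makes every annihilator `ann a` the ideal of
an idempotent `e`, so that `a` vanishes on the factor `eR` of `R` and is regular on `(1 - e)R`,
and `a + e` is regular. Two properties of `R` follow.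

* A finite family `f` is a multiple `d • g` of a *unimodular* family (`IsHermite`): divide `f` by a
  generator `d` of its span, and correct the quotient on the factor where `d` vanishes. Over such a
  ring a unimodular vector is the first column of an invertible matrix
  (`IsHermite.exists_isUnit_mulVec_single`).
* *Kaplansky's condition* (`KaplanskyCondition`): if `a, b, c` generate the unit ideal, then so do
  `p * a` and `p * b + q * c` for some `p, q`. Where `a` is regular it is adequate, and the part
  `r` of `a` prime to `b` gives `p = 1`, `q = r`; where `a = 0`, the elements `b` and `c` are
  already coprime.

These two properties suffice. If the entries of `A` generate the unit ideal, then `u A v = 1` for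
some vectors `u, v`, by induction on the number of rows (`exists_vecMul_dotProduct_eq_one`):
Kaplansky's condition combines the first row with the row found for the remaining ones. Completing
`u` and `v` to invertible matrices splits off a diagonal entry `1`
(`exists_isUnit_mul_mul_eq_bordered`). A general matrix is `d` times one with unimodular entries,
so its reduction is `d` times `diag(1, B)`, and `B` has smaller size.
-/

open Matrix

/-- Every nonempty finite family is a multiple of a unimodular one. For families of two elements
this is Kaplansky's notion of a Hermite ring; stating it for all finite families saves an
induction. -/
def IsHermite (R : Type*) [CommRing R] : Prop :=
  ∀ (ι : Type) [Fintype ι] [Nonempty ι] (f : ι → R),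
    ∃ (d : R) (g h : ι → R), f = d • g ∧ h ⬝ᵥ g = 1

/-- Kaplansky's condition: if `a, b, c` generate the unit ideal, then the matrix with rows
`(a, b)` and `(0, c)` has a unimodular combination `(p * a, p * b + q * c)` of its rows. -/
def KaplanskyCondition (R : Type*) [CommRing R] : Prop :=
  ∀ a b c α β γ : R, α * a + β * b + γ * c = 1 → ∃ p q : R, IsCoprime (p * a) (p * b + q * c)

/-! ### Consequences of semiheredity -/

section Annihilators

variable {R : Type*} [CommRing R]

/-- Since the principal ideal `Ra` is projective, `r ↦ r * a` splits as a map `R → Ra`, and hence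
the annihilator of `a` is generated by an idempotent `e`. -/
theorem IsSemihereditary.exists_idempotent (hS : IsSemihereditary R) (a : R) :
    ∃ e : R, e * e = e ∧ e * a = 0 ∧ ∀ x, x * a = 0 → x * e = x := by
  have : Module.Projective R (Ideal.span {a}) := hS _ ⟨{a}, by simp⟩
  let a' : Ideal.span {a} := ⟨a, Ideal.mem_span_singleton_self a⟩
  let f : R →ₗ[R] Ideal.span {a} := LinearMap.toSpanSingleton R _ a'
  have hf : Function.Surjective f := by
    rintro ⟨x, hx⟩
    obtain ⟨y, rfl⟩ := Ideal.mem_span_singleton'.1 hx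
    exact ⟨y, rfl⟩
  obtain ⟨s, hs⟩ := Module.projective_lifting_property f LinearMap.id hf
  have hta : s a' * a = a := congrArg Subtype.val (LinearMap.congr_fun hs a')
  have key : ∀ x, x * a = 0 → x * (1 - s a') = x := by
    intro x hx
    have h0 : x • a' = 0 := Subtype.ext hx
    have h1 : x * s a' = 0 := by
      have := map_smul s x a'
      rw [h0, map_zero, smul_eq_mul] at this
      exact this.symm
    linear_combination -h1
  have hea : (1 - s a') * a = 0 := by linear_combination -hta
  exact ⟨1 - s a', key _ hea, hea, key⟩

theorem isHermite_of_isBezout (hB : IsBezout R) (hS : IsSemihereditary R) : IsHermite R := by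
  classical
  intro ι _ _ f
  obtain ⟨d, hd⟩ := (hB.isPrincipal_of_FG (Ideal.span (Set.range f))
    ⟨Finset.univ.image f, by simp⟩).principal
  have hdiv : ∀ i, ∃ g, g * d = f i := fun i => by
    have h : f i ∈ Ideal.span (Set.range f) := Ideal.subset_span ⟨i, rfl⟩
    rw [hd] at h
    exact Ideal.mem_span_singleton'.1 h
  choose g hg using hdiv
  have hmem : d ∈ Ideal.span (Set.range f) := by
    rw [hd]; exact Ideal.mem_span_singleton_self d
  obtain ⟨h, hh⟩ := Ideal.mem_span_range_iff_exists_fun.1 hmem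
  obtain ⟨e, hee, hed, he⟩ := hS.exists_idempotent d
  have hsum : (1 - h ⬝ᵥ g) * d = 0 := by
    have : (h ⬝ᵥ g) * d = d := by
      rw [dotProduct, Finset.sum_mul]
      conv_rhs => rw [← hh]
      exact Finset.sum_congr rfl fun i _ => by rw [← hg i]; ring
    linear_combination -this
  have h1 := he _ hsum
  obtain ⟨i₀⟩ := ‹Nonempty ι›
  -- On the factor `eR`, where `d` vanishes, the quotient is replaced by a basis vector.
  refine ⟨d, (1 - e) • g + e • Pi.single i₀ 1, (1 - e) • h + e • Pi.single i₀ 1, ?_, ?_⟩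
  · ext i
    simp only [Pi.smul_apply, Pi.add_apply, smul_eq_mul]
    rw [← hg i]
    linear_combination (g i - (Pi.single i₀ 1 : ι → R) i) * hed
  · simp only [add_dotProduct, dotProduct_add, smul_dotProduct, dotProduct_smul, smul_eq_mul,
      single_dotProduct, dotProduct_single, Pi.add_apply, Pi.smul_apply, Pi.single_eq_same,
      mul_one, one_mul]
    linear_combination (h ⬝ᵥ g - g i₀ - h i₀ + 1) * hee + h1

end Annihilators

/-! ### Adequate elements and Kaplansky's condition -/

section Adequate

variable {R : Type*} [CommRing R]

/-- If `a` is adequate and `a, b, c` generate the unit ideal, then `a` and `b + r * c` are coprime,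
`r` being the part of `a` that is prime to `b`. -/
theorem IsAdequate.exists_isCoprime_add_mul (hB : IsBezout R) {a b c α β γ : R}
    (ha : IsAdequate a) (h : α * a + β * b + γ * c = 1) : ∃ r, IsCoprime a (b + r * c) := by
  obtain ⟨r, s, rfl, hrb, hs⟩ := ha b
  refine ⟨r, IsCoprime.mul_left (hrb.add_mul_left_right c) ?_⟩
  obtain ⟨t, ht⟩ := (hB.isPrincipal_of_FG (Ideal.span {s, b + r * c})
    (Submodule.fg_span (Set.toFinite _))).principal
  have hts : t ∣ s := by
    refine Ideal.mem_span_singleton.1 ?_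
    rw [Ideal.span, ← ht]
    exact Ideal.subset_span (by simp)
  have htb : t ∣ b + r * c := by
    refine Ideal.mem_span_singleton.1 ?_
    rw [Ideal.span, ← ht]
    exact Ideal.subset_span (by simp)
  by_cases hu : IsUnit t
  · rw [← Ideal.isCoprime_span_singleton_iff, Ideal.isCoprime_iff_sup_eq, ← Ideal.span_union,
      Set.singleton_union]
    rw [ht]
    exact Ideal.span_singleton_eq_top.2 hu
  · -- Modulo `t` and `b`, both `a` and `r * c` vanish, while `r` is invertible.
    refine absurd ?_ (hs t hts hu)
    obtain ⟨k, rfl⟩ := hts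
    obtain ⟨l, hl⟩ := htb
    obtain ⟨ρ, σ, hρ⟩ := hrb
    refine ⟨ρ * r * α * r * k + γ * ρ * l, σ + ρ * r * β - γ * ρ, ?_⟩
    linear_combination hρ + ρ * r * h - γ * ρ * hl

theorem kaplanskyCondition_of_isAdequate (hB : IsBezout R) (hS : IsSemihereditary R)
    (hA : ∀ a ∈ nonZeroDivisors R, IsAdequate a) : KaplanskyCondition R := by
  intro a b c α β γ h
  obtain ⟨e, hee, hea, he⟩ := hS.exists_idempotent a
  have hreg : a + e ∈ nonZeroDivisors R := by
    rw [mem_nonZeroDivisors_iff_right]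
    intro x hx
    have hxe : x * e = 0 := by linear_combination e * hx - x * hea - x * hee
    have hxa : x * a = 0 := by linear_combination hx - hxe
    rw [← he x hxa, hxe]
  have h' : ((1 - e) * α + e) * (a + e) + (1 - e) * β * b + (1 - e) * γ * c = 1 := by
    linear_combination (1 - e) * h + (1 - α) * hee + hea
  obtain ⟨r, x, y, hxy⟩ := (hA _ hreg).exists_isCoprime_add_mul hB h'
  -- The pairs `(1, r)` and `(β, γ)` are glued along `R = (1 - e)R × eR`.
  refine ⟨(1 - e) + e * β, (1 - e) * r + e * γ, (1 - e) * x, (1 - e) * y + e, ?_⟩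
  linear_combination (1 - e) * hxy + e * h - α * hea +
    (x * a - x * a * β + x + (y - 1) * (b + r * c) - (y - 1) * (β * b + γ * c)) * hee

end Adequate

/-! ### Completing unimodular vectors -/

section Completion

variable {R : Type*} [CommRing R] {ι : Type*} [DecidableEq ι]

/-- The automorphism of `ι → R` that acts on the coordinates `i ≠ j` through the matrix with rows
`(x, y)` and `(-b, a)`, of determinant `1`, and fixes the other coordinates. -/
def planeEquiv (i j : ι) (hij : i ≠ j) (a b x y : R) (h : x * a + y * b = 1) :
    (ι → R) ≃ₗ[R] (ι → R) where
  toFun w := Function.update (Function.update w i (x * w i + y * w j)) j (-b * w i + a * w j)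
  invFun w := Function.update (Function.update w i (a * w i - y * w j)) j (b * w i + x * w j)
  map_add' v w := by
    ext k
    by_cases hj : k = j
    · subst hj; simp; ring
    · by_cases hi : k = i
      · subst hi; simp [hj]; ring
      · simp [hi, hj]
  map_smul' r w := by
    ext k
    by_cases hj : k = j
    · subst hj; simp; ring
    · by_cases hi : k = i
      · subst hi; simp [hj]; ring
      · simp [hi, hj]
  left_inv w := by
    ext k
    by_cases hj : k = j
    · subst hj; simp [hij]; linear_combination w k * h
    · by_cases hi : k = i
      · subst hi; simp [hj]; linear_combination w k * h
      · simp [hi, hj]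
  right_inv w := by
    ext k
    by_cases hj : k = j
    · subst hj; simp [hij]; linear_combination w k * h
    · by_cases hi : k = i
      · subst hi; simp [hj]; linear_combination w k * h
      · simp [hi, hj]

theorem IsHermite.exists_linearEquiv_apply_eq_zero (hH : IsHermite R) (v : ι → R) (i : ι)
    (s : Finset ι) (hi : i ∉ s) :
    ∃ Q : (ι → R) ≃ₗ[R] (ι → R), ∀ j ∈ s, Q v j = 0 := by
  induction s using Finset.induction_on with
  | empty => exact ⟨LinearEquiv.refl R _, by simp⟩
  | insert j s hj ih =>
    rw [Finset.mem_insert, not_or] at hi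
    obtain ⟨Q, hQ⟩ := ih hi.2
    obtain ⟨d, g, h, hf, hg⟩ := hH (Fin 2) ![Q v i, Q v j]
    have h0 : Q v i = d * g 0 := congrFun hf 0
    have h1 : Q v j = d * g 1 := congrFun hf 1
    have hg' : h 0 * g 0 + h 1 * g 1 = 1 := by
      rw [← hg, dotProduct, Fin.sum_univ_two]
    refine ⟨Q.trans (planeEquiv i j hi.1 (g 0) (g 1) (h 0) (h 1) hg'), fun k hk => ?_⟩
    change Function.update (Function.update (Q v) i _) j (-g 1 * Q v i + g 0 * Q v j) k = 0
    by_cases hkj : k = j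
    · subst hkj
      rw [Function.update_self, h0, h1]
      ring
    · have hks : k ∈ s := (Finset.mem_insert.1 hk).resolve_left hkj
      have hki : k ≠ i := fun h => hi.2 (h ▸ hks)
      rw [Function.update_of_ne hkj, Function.update_of_ne hki, hQ k hks]

variable [Fintype ι]

/-- Over a Hermite ring, a unimodular vector is a column of an invertible matrix. -/
theorem IsHermite.exists_isUnit_mulVec_single (hH : IsHermite R) {z v : ι → R} (hzv : z ⬝ᵥ v = 1)
    (i : ι) : ∃ Q : Matrix ι ι R, IsUnit Q ∧ Q *ᵥ Pi.single i 1 = v := by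
  obtain ⟨E, hE⟩ := hH.exists_linearEquiv_apply_eq_zero v i (Finset.univ.erase i) (by simp)
  set d := E v i with hd
  have hEv : E v = Pi.single i d := by
    ext j
    by_cases hj : j = i
    · subst hj; simp [hd]
    · rw [hE j (by simp [hj]), Pi.single_eq_of_ne hj]
  set M := LinearMap.toMatrix' E.symm.toLinearMap with hM
  have hMd : M *ᵥ Pi.single i d = v := by
    rw [hM, LinearMap.toMatrix'_mulVec, ← hEv]
    exact E.symm_apply_apply v
  have hMu : IsUnit M := by
    refine IsUnit.of_mul_eq_one_right (LinearMap.toMatrix' E.toLinearMap) ?_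
    rw [hM, ← LinearMap.toMatrix'_comp]
    simp
  have hsingle : (Pi.single i d : ι → R) = d • Pi.single i 1 := by
    rw [← Pi.single_smul, smul_eq_mul, mul_one]
  rw [hsingle, mulVec_smul] at hMd
  have hdu : IsUnit d := by
    refine IsUnit.of_mul_eq_one (z ⬝ᵥ M *ᵥ Pi.single i 1) ?_
    rw [← smul_eq_mul, ← dotProduct_smul, hMd, hzv]
  refine ⟨d • M, ?_, by rw [smul_mulVec, hMd]⟩
  obtain ⟨t, ht⟩ := hdu
  rw [← ht]
  exact hMu.smul t

/-- A basis adapted to the splitting of `ι → R` into the line through `v` and the kernel of `z`. -/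
theorem IsHermite.exists_isUnit_mulVec_vecMul (hH : IsHermite R) {z v : ι → R} (hzv : z ⬝ᵥ v = 1)
    (i : ι) : ∃ Q : Matrix ι ι R,
      IsUnit Q ∧ Q *ᵥ Pi.single i 1 = v ∧ z ᵥ* Q = Pi.single i 1 := by
  obtain ⟨M, hM, hMv⟩ := hH.exists_isUnit_mulVec_single hzv i
  set y : ι → R := z ᵥ* M - Pi.single i 1 with hy
  have hzM : (z ᵥ* M) ⬝ᵥ Pi.single i 1 = 1 := by rw [← dotProduct_mulVec, hMv, hzv]
  have hyi : y ⬝ᵥ Pi.single i 1 = 0 := by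
    rw [hy, sub_dotProduct, hzM]; simp
  have hN : vecMulVec (Pi.single i 1) y * vecMulVec (Pi.single i 1) y = 0 := by
    rw [vecMulVec_mul_vecMulVec, hyi]; simp
  refine ⟨M * (1 - vecMulVec (Pi.single i 1) y), hM.mul ?_, ?_, ?_⟩
  · refine IsUnit.of_mul_eq_one_right (1 + vecMulVec (Pi.single i 1) y) ?_
    rw [mul_sub, add_mul, add_mul, hN]
    simp
  · rw [← mulVec_mulVec, sub_mulVec, vecMulVec_mulVec, hyi]
    rw [one_mulVec, MulOpposite.op_zero, zero_smul, sub_zero, hMv]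
  · rw [← vecMul_vecMul, vecMul_sub, vecMul_vecMulVec, hzM, vecMul_one, one_smul, hy]
    abel

end Completion

/-! ### Diagonal reduction -/

section Reduction

variable {R : Type*} [CommRing R]

/-- If the entries of `A` generate the unit ideal, the bilinear form of `A` takes the value `1`. -/
theorem exists_vecMul_dotProduct_eq_one (hH : IsHermite R) (hK : KaplanskyCondition R) {m n : ℕ}
    (A H : Matrix (Fin (m + 1)) (Fin (n + 1)) R) (hA : ∑ i, H i ⬝ᵥ A i = 1) :
    ∃ u v, (u ᵥ* A) ⬝ᵥ v = 1 := by
  induction m with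
  | zero =>
    refine ⟨Pi.single 0 1, H 0, ?_⟩
    rw [single_one_vecMul, dotProduct_comm]
    rwa [Fin.sum_univ_one] at hA
  | succ m ih =>
    -- The rows after the first are `d • B` with `B` unimodular.
    obtain ⟨d, g, h, hf, hg⟩ := hH (Fin (m + 1) × Fin (n + 1)) fun k => A k.1.succ k.2
    let B : Matrix (Fin (m + 1)) (Fin (n + 1)) R := fun i j => g (i, j)
    have hAB : ∀ i, A i.succ = d • B i := fun i => funext fun j => congrFun hf (i, j)
    obtain ⟨u, v, huv⟩ := ih B (fun i j => h (i, j)) (by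
      rw [← hg]; simp only [dotProduct, Fintype.sum_prod_type]; rfl)
    set z := u ᵥ* B with hz
    set b := A 0 ⬝ᵥ v with hb
    -- The first row is `b • z + c • w`, the second summand being orthogonal to `v`.
    obtain ⟨c, w, k, hw, hk⟩ := hH (Fin (n + 1)) (A 0 - b • z)
    have hA0 : A 0 = b • z + c • w := by rw [← hw]; abel
    have hcw : c * (w ⬝ᵥ v) = 0 := by
      rw [← smul_eq_mul, ← smul_dotProduct, ← hw, sub_dotProduct, smul_dotProduct, huv]
      simp [hb]
    have hunit : (H 0 ⬝ᵥ w) * c + (H 0 ⬝ᵥ z) * b +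
        (∑ i : Fin (m + 1), H i.succ ⬝ᵥ B i) * d = 1 := by
      rw [← hA, Fin.sum_univ_succ (n := m + 1), hA0, Finset.sum_mul]
      simp only [hAB, dotProduct_add, dotProduct_smul, smul_eq_mul, mul_comm d]
      ring
    obtain ⟨q, p, x, y, hxy⟩ := hK c b d _ _ _ hunit
    -- The new row is `(q * b + p * d) • z + (q * c) • w`. Pairing it with `v` and with
    -- `k - (k ⬝ᵥ z) • v`, which is orthogonal to `z`, gives its two coefficients.
    refine ⟨Fin.cons q (p • u), y • v + x • (k - (k ⬝ᵥ z) • v), ?_⟩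
    have hrow : (Fin.cons q (p • u) : Fin (m + 2) → R) ᵥ* A
        = (q * b + p * d) • z + (q * c) • w := by
      ext j
      have h0 : A 0 j = b * z j + c * w j := congrFun hA0 j
      have hS : ∀ i : Fin (m + 1), A i.succ j = d * B i j := fun i => congrFun (hAB i) j
      have hzj : z j = ∑ i, u i * B i j := rfl
      have : ∑ i, p * u i * (d * B i j) = p * d * z j := by
        rw [hzj, Finset.mul_sum]
        exact Finset.sum_congr rfl fun i _ => by ring
      simp only [vecMul, dotProduct, Fin.sum_univ_succ (n := m + 1), Fin.cons_zero, Fin.cons_succ,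
        Pi.smul_apply, smul_eq_mul, hS, h0, this, Pi.add_apply]
      ring
    rw [hrow]
    simp only [add_dotProduct, dotProduct_add, smul_dotProduct, dotProduct_smul, dotProduct_sub,
      smul_eq_mul, huv, dotProduct_comm w k, dotProduct_comm z k, hk]
    linear_combination hxy + (y * q - x * q * (k ⬝ᵥ z)) * hcw

/-- The block diagonal matrix `diag(a, B)`, indexed by `Fin (m + 1)` and `Fin (n + 1)`. -/
def bordered {m n : ℕ} (a : R) (B : Matrix (Fin m) (Fin n) R) :
    Matrix (Fin (m + 1)) (Fin (n + 1)) R :=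
  Matrix.of (Fin.cons (Fin.cons a 0) fun i => Fin.cons 0 (B i))

@[simp]
theorem bordered_zero_zero {m n : ℕ} (a : R) (B : Matrix (Fin m) (Fin n) R) :
    bordered a B 0 0 = a := rfl

@[simp]
theorem bordered_zero_succ {m n : ℕ} (a : R) (B : Matrix (Fin m) (Fin n) R) (j : Fin n) :
    bordered a B 0 j.succ = 0 := rfl

@[simp]
theorem bordered_succ_zero {m n : ℕ} (a : R) (B : Matrix (Fin m) (Fin n) R) (i : Fin m) :
    bordered a B i.succ 0 = 0 := rfl

@[simp]
theorem bordered_succ_succ {m n : ℕ} (a : R) (B : Matrix (Fin m) (Fin n) R) (i : Fin m)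
    (j : Fin n) : bordered a B i.succ j.succ = B i j := rfl

theorem bordered_mul_bordered {l m n : ℕ} (a b : R) (B : Matrix (Fin l) (Fin m) R)
    (C : Matrix (Fin m) (Fin n) R) : bordered a B * bordered b C = bordered (a * b) (B * C) := by
  ext i j
  refine Fin.cases ?_ (fun i => ?_) i <;> refine Fin.cases ?_ (fun j => ?_) j <;>
    simp [Matrix.mul_apply, Fin.sum_univ_succ]

theorem isUnit_bordered_one {m : ℕ} {B : Matrix (Fin m) (Fin m) R} (hB : IsUnit B) :
    IsUnit (bordered 1 B) := by
  obtain ⟨C, hC⟩ := hB.exists_left_inv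
  refine IsUnit.of_mul_eq_one_right (bordered 1 C) ?_
  rw [bordered_mul_bordered, hC]
  ext i j
  refine Fin.cases ?_ (fun i => ?_) i <;> refine Fin.cases ?_ (fun j => ?_) j <;>
    simp [Matrix.one_apply, Fin.succ_ne_zero, (Fin.succ_ne_zero _).symm]

theorem exists_isUnit_mul_mul_eq_bordered (hH : IsHermite R) {m n : ℕ}
    (A : Matrix (Fin (m + 1)) (Fin (n + 1)) R) {u : Fin (m + 1) → R} {v : Fin (n + 1) → R}
    (huv : (u ᵥ* A) ⬝ᵥ v = 1) :
    ∃ (P : Matrix (Fin (m + 1)) (Fin (m + 1)) R) (Q : Matrix (Fin (n + 1)) (Fin (n + 1)) R)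
      (B : Matrix (Fin m) (Fin n) R), IsUnit P ∧ IsUnit Q ∧ P * A * Q = bordered 1 B := by
  obtain ⟨Q, hQ, hQv, hQz⟩ := hH.exists_isUnit_mulVec_vecMul huv 0
  have hvu : (A *ᵥ v) ⬝ᵥ u = 1 := by rw [dotProduct_comm, dotProduct_mulVec, huv]
  obtain ⟨P, hP, hPu, hPy⟩ := hH.exists_isUnit_mulVec_vecMul hvu 0
  have hrow : Pi.single 0 1 ᵥ* (Pᵀ * A * Q) = Pi.single 0 1 := by
    rw [← vecMul_vecMul, ← vecMul_vecMul, vecMul_transpose, hPu, hQz]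
  have hcol : (Pᵀ * A * Q) *ᵥ Pi.single 0 1 = Pi.single 0 1 := by
    rw [← mulVec_mulVec, hQv, ← mulVec_mulVec, mulVec_transpose, hPy]
  rw [single_one_vecMul] at hrow
  rw [mulVec_single_one] at hcol
  refine ⟨Pᵀ, Q, (Pᵀ * A * Q).submatrix Fin.succ Fin.succ, (isUnit_transpose P).2 hP, hQ, ?_⟩
  ext i j
  refine Fin.cases (?_) (fun i => ?_) i
  · rw [show (Pᵀ * A * Q) 0 j = _ from congrFun hrow j]
    refine Fin.cases ?_ (fun j => ?_) j <;> simp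
  · refine Fin.cases ?_ (fun j => ?_) j
    · rw [show (Pᵀ * A * Q) i.succ 0 = _ from congrFun hcol i.succ]
      simp
    · simp

theorem IsElementaryDivisorForm.smul_bordered_one {m n : ℕ} {D : Matrix (Fin m) (Fin n) R}
    (hD : IsElementaryDivisorForm D) (d : R) : IsElementaryDivisorForm (d • bordered 1 D) := by
  refine ⟨fun i j => ?_, fun k hm hn => ?_⟩
  · refine Fin.cases ?_ (fun i => ?_) i <;> refine Fin.cases ?_ (fun j => ?_) j <;> intro hij
    · exact absurd rfl hij
    · simp
    · simp
    · have : D i j = 0 := hD.1 i j fun h => hij (by simp [h])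
      simp [this]
  · cases k with
    | zero => exact mul_dvd_mul_left d (one_dvd _)
    | succ k =>
      exact mul_dvd_mul_left d (hD.2 k (Nat.lt_of_succ_lt_succ hm) (Nat.lt_of_succ_lt_succ hn))

theorem IsHermite.isElementaryDivisorRing (hH : IsHermite R) (hK : KaplanskyCondition R) :
    IsElementaryDivisorRing R := by
  intro m
  induction m with
  | zero =>
    exact fun n A => ⟨1, 1, isUnit_one, isUnit_one, fun i => i.elim0,
      fun k hm => absurd hm (Nat.not_lt_zero _)⟩
  | succ m ih =>
    intro n A
    cases n with
    | zero =>
      exact ⟨1, 1, isUnit_one, isUnit_one, fun _ j => j.elim0,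
        fun k _ hn => absurd hn (Nat.not_lt_zero _)⟩
    | succ n =>
      obtain ⟨d, g, h, hf, hg⟩ := hH (Fin (m + 1) × Fin (n + 1)) fun k => A k.1 k.2
      let C : Matrix (Fin (m + 1)) (Fin (n + 1)) R := fun i j => g (i, j)
      have hAC : A = d • C := by
        ext i j
        exact congrFun hf (i, j)
      obtain ⟨u, v, huv⟩ := exists_vecMul_dotProduct_eq_one hH hK C (fun i j => h (i, j)) (by
        rw [← hg]; simp only [dotProduct, Fintype.sum_prod_type]; rfl)
      obtain ⟨P, Q, B, hP, hQ, hPQ⟩ := exists_isUnit_mul_mul_eq_bordered hH C huv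
      obtain ⟨P', Q', hP', hQ', hD⟩ := ih n B
      refine ⟨bordered 1 P' * P, Q * bordered 1 Q', (isUnit_bordered_one hP').mul hP,
        hQ.mul (isUnit_bordered_one hQ'), ?_⟩
      have : bordered 1 P' * P * A * (Q * bordered 1 Q') = d • bordered 1 (P' * B * Q') := by
        calc bordered 1 P' * P * A * (Q * bordered 1 Q')
            = d • (bordered 1 P' * (P * C * Q) * bordered 1 Q') := by
              rw [hAC]; simp only [Matrix.mul_smul, Matrix.smul_mul, Matrix.mul_assoc]
          _ = _ := by rw [hPQ, bordered_mul_bordered, bordered_mul_bordered]; simp only [one_mul]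
      rw [this]
      exact hD.smul_bordered_one d

end Reduction

theorem theorem13 {R : Type*} [CommRing R] (hB : IsBezout R) (hS : IsSemihereditary R)
    (hA : ∀ a ∈ nonZeroDivisors R, IsAdequate a) : IsElementaryDivisorRing R :=
  (isHermite_of_isBezout hB hS).isElementaryDivisorRing
    (kaplanskyCondition_of_isAdequate hB hS hA)
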